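/- Let $\Omega\subset\mathbb{R}^n$ be a bounded open set, and let $C_\Omega>0$ be a constant with $\|w\|_{L^1(\Omega)}\le C_\Omega\int_\Omega|Dw|\,dx$ for all $w\in H^1_0(\Omega)$. Let $m,M,k_1,\sigma_1>0$ and $0\le h<m/C_\Omega$. Then there is a constant $C$, depending only on $\Omega$ (and $C_\Omega$), $m$, $M$, $k_1$, $\sigma_1$ and $h$, with the following property. Let $F\in L^1(\Omega)^n$ with $\|F\|_{L^1(\Omega)}\le k_1$, let $H\in L^\infty(\Omega)$ with $\|H\|_{L^\infty(\Omega)}\le h$ (hence $\|H\|_{L^\infty(\Omega)}<m/C_\Omega$), and let $a,\tilde a$ be measurable with $m\le a,\tilde a\le M$ a.e. in $\Omega$. Suppose that $u$ minimizes $$w\mapsto\int_\Omega\big(a|Dw+F|+Hw\big)\,dx$$ over $H^1_0(\Omega)$ and that the coefficient $\sigma:=a/|Du+F|\in[0,\infty]$ (equal to $\infty$ where $Du+F=0$) satisfies $0\le\sigma\le\sigma_1$ a.e. in $\Omega$. Let $J$ be any solution of the dual problem $$\sup\Big\{\int_\Omega F\cdot b\,dx:\ b\in L^2(\Omega)^n,\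 |b|\le a\text{ a.e. in }\Omega,\ \int_\Omega(\nabla w\cdot b+Hw)\,dx=0\text{ for all }w\in H^1_0(\Omega)\Big\},$$ and let $\tilde J$ be any solution of the same problem with $\tilde a$ in place of $a$. Then $$\|J-\tilde J\|_{L^1(\Omega)}\le C\,\|a-\tilde a\|_{L^\infty(\Omega)}^{1/2}.$$ -/

import Mathlib

open MeasureTheory Filter Topology
open scoped ENNReal NNReal ContDiff RealInnerProductSpace

namespace WeightedLeastGradient

/-- `n`-dimensional Euclidean space. -/
abbrev Euc (n : ℕ) : Type := EuclideanSpace ℝ (Fin n)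

/-- Test functions on `Ω`: smooth functions with compact support contained in `Ω`. -/
def IsTest {n : ℕ} (Ω : Set (Euc n)) (φ : Euc n → ℝ) : Prop :=
  ContDiff ℝ ∞ φ ∧ HasCompactSupport φ ∧ tsupport φ ⊆ Ω

/-- `Du` is the weak gradient of `u` in `Ω`. -/
def HasWeakGradient {n : ℕ} (Ω : Set (Euc n)) (u : Euc n → ℝ) (Du : Euc n → Euc n) : Prop :=
  ∀ φ : Euc n → ℝ, IsTest Ω φ → ∀ v : Euc n,
    ∫ x in Ω, u x * fderiv ℝ φ x v = - ∫ x in Ω, ⟪Du x, v⟫ * φ x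

/-- `u ∈ H¹₀(Ω)` with weak gradient `Du`: both belong to `L²(Ω)`, and `u` is a limit of test
functions in the norm of `H¹(Ω)`. -/
structure MemH10 {n : ℕ} (Ω : Set (Euc n)) (u : Euc n → ℝ) (Du : Euc n → Euc n) : Prop where
  memLp : MemLp u 2 (volume.restrict Ω)
  memLp_grad : MemLp Du 2 (volume.restrict Ω)
  weakGradient : HasWeakGradient Ω u Du
  approx : ∃ φ : ℕ → Euc n → ℝ, (∀ k, IsTest Ω (φ k)) ∧
    Tendsto (fun k => eLpNorm (fun x => u x - φ k x) 2 (volume.restrict Ω)) atTop (𝓝 0) ∧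
    Tendsto (fun k => eLpNorm (fun x => Du x - gradient (φ k) x) 2 (volume.restrict Ω))
      atTop (𝓝 0)

/-- `K` is a Poincaré constant of `Ω`: `‖u‖_{L¹(Ω)} ≤ K ∫_Ω |Du|` for functions `u` that vanish on
the boundary. It is enough to ask this of `u ∈ H¹₀(Ω)`; a constant that is valid for all
functions of bounded variation with zero trace is in particular one in this sense. -/
def IsPoincareConst {n : ℕ} (Ω : Set (Euc n)) (K : ℝ) : Prop :=
  0 < K ∧ ∀ (u : Euc n → ℝ) (Du : Euc n → Euc n), MemH10 Ω u Du →
    ∫ x in Ω, |u x| ≤ K * ∫ x in Ω, ‖Du x‖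

/-- The energy `∫_Ω (a |Dw + F| + H w) dx`. -/
noncomputable def energy {n : ℕ} (Ω : Set (Euc n)) (a : Euc n → ℝ) (F : Euc n → Euc n)
    (H : Euc n → ℝ) (w : Euc n → ℝ) (Dw : Euc n → Euc n) : ℝ :=
  ∫ x in Ω, (a x * ‖Dw x + F x‖ + H x * w x)

/-- `u` (with weak gradient `Du`) minimizes the energy over `H¹₀(Ω)`. -/
def IsMinimizer {n : ℕ} (Ω : Set (Euc n)) (a : Euc n → ℝ) (F : Euc n → Euc n)
    (H : Euc n → ℝ) (u : Euc n → ℝ) (Du : Euc n → Euc n) : Prop :=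
  MemH10 Ω u Du ∧ ∀ (w : Euc n → ℝ) (Dw : Euc n → Euc n), MemH10 Ω w Dw →
    energy Ω a F H u Du ≤ energy Ω a F H w Dw

/-- The space `𝒟₀` of fields `b ∈ L²(Ω)ⁿ` with `∫_Ω (∇w · b + H w) = 0` for all `w ∈ H¹₀(Ω)`. -/
def MemD0 {n : ℕ} (Ω : Set (Euc n)) (H : Euc n → ℝ) (b : Euc n → Euc n) : Prop :=
  MemLp b 2 (volume.restrict Ω) ∧
    ∀ (w : Euc n → ℝ) (Dw : Euc n → Euc n), MemH10 Ω w Dw →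
      ∫ x in Ω, (⟪Dw x, b x⟫ + H x * w x) = 0

/-- Admissible fields of the dual problem: `b ∈ 𝒟₀` and `|b| ≤ a` a.e. in `Ω`. -/
def IsDualFeasible {n : ℕ} (Ω : Set (Euc n)) (a : Euc n → ℝ) (H : Euc n → ℝ)
    (b : Euc n → Euc n) : Prop :=
  MemD0 Ω H b ∧ ∀ᵐ x ∂(volume.restrict Ω), ‖b x‖ ≤ a x

/-- `J` solves the dual problem `sup { ⟨F, b⟩ : b ∈ 𝒟₀, |b| ≤ a a.e. in Ω }`. -/
def IsDualSolution {n : ℕ} (Ω : Set (Euc n)) (a : Euc n → ℝ) (F : Euc n → Euc n)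
    (H : Euc n → ℝ) (J : Euc n → Euc n) : Prop :=
  IsDualFeasible Ω a H J ∧ ∀ b : Euc n → Euc n, IsDualFeasible Ω a H b →
    ∫ x in Ω, ⟪F x, b x⟫ ≤ ∫ x in Ω, ⟪F x, J x⟫

/-- The coefficient `σ = a / |Du + F|`, with values in `[0, ∞]`; it is `∞` where `a > 0` and
`Du + F = 0`. -/
noncomputable def sigma {n : ℕ} (a : Euc n → ℝ) (F Du : Euc n → Euc n) (x : Euc n) : ℝ≥0∞ :=
  ENNReal.ofReal (a x) / ‖Du x + F x‖ₑ

end WeightedLeastGradient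

/-!
Write `p = Du + F` and `κ = h C_Ω < m`. The bound on `σ` says that `p ≠ 0` almost everywhere, so
the energy is differentiable at `u`, and its Euler–Lagrange equation puts the field `a p / |p|`
into `𝒟₀` (`IsMinimizer.memD0`). For `b ∈ 𝒟₀` the integrals `∫ F · b` and `∫ p · b` differ by a
constant, so the dual problem maximizes `∫ p · b` subject to `|b| ≤ a`; the field `a p / |p|`
attains the pointwise maximum, and `J = a p / |p|` (`IsDualSolution.ae_eq_normalized`).

Pointwise, `|J - J'|² ≤ (a - a')² + 2 σ (a' |p| - p · J')` (`norm_smul_sub_sq_le`), where `σ ≤ σ₁`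
and the last factor is nonnegative. Its integral is of order `δ = ‖a - a'‖_∞`, since `J'` does at
least as well as any competitor admissible for `a'` (`integral_defect_le`). If `b₀ ∈ 𝒟₀` has
`|b₀| ≤ κ`, then for `s = δ / (m - κ) ≤ 1` the field `(1 - s) J + s b₀` is such a competitor and
loses only a multiple of `δ ∫ |p|`; the integral `∫ |p|` is bounded by comparing `u` with `0`
(`IsMinimizer.integral_norm_le`). The field `b₀` comes from the Poincaré inequality and the
Hahn–Banach theorem (`exists_memD0_norm_le`). The Cauchy–Schwarz inequality then gives the order
`δ^(1/2)` in `L¹`; for `δ ≥ m - κ` the bound `|J - J'| ≤ 2 M` suffices.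
-/

namespace WeightedLeastGradient

/-! ### The space `H¹₀(Ω)` -/

lemma IsTest.add_const_mul {n : ℕ} {Ω : Set (Euc n)} {φ ψ : Euc n → ℝ} (hφ : IsTest Ω φ)
    (hψ : IsTest Ω ψ) (c : ℝ) : IsTest Ω (fun x => φ x + c * ψ x) := by
  have hcψ : tsupport (fun x => c * ψ x) ⊆ tsupport ψ := tsupport_mul_subset_right
  refine ⟨hφ.1.add (contDiff_const.mul hψ.1), hφ.2.1.add hψ.2.1.mul_left, ?_⟩
  exact (tsupport_add φ fun x => c * ψ x).trans
    (Set.union_subset hφ.2.2 (hcψ.trans hψ.2.2))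

lemma IsTest.continuous_gradient {n : ℕ} {Ω : Set (Euc n)} {φ : Euc n → ℝ} (hφ : IsTest Ω φ) :
    Continuous (gradient φ) :=
  (InnerProductSpace.toDual ℝ (Euc n)).symm.continuous.comp
    (hφ.1.continuous_fderiv (by simp))

lemma IsTest.gradient_add_const_mul {n : ℕ} {Ω : Set (Euc n)} {φ ψ : Euc n → ℝ}
    (hφ : IsTest Ω φ) (hψ : IsTest Ω ψ) (c : ℝ) (x : Euc n) :
    gradient (fun x => φ x + c * ψ x) x = gradient φ x + c • gradient ψ x := by
  have h1 : DifferentiableAt ℝ φ x := hφ.1.differentiable (by simp) x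
  have h2 : DifferentiableAt ℝ ψ x := hψ.1.differentiable (by simp) x
  refine HasGradientAt.gradient ?_
  rw [hasGradientAt_iff_hasFDerivAt, map_add, map_smul, toDual_gradient, toDual_gradient]
  exact h1.hasFDerivAt.add (h2.hasFDerivAt.const_mul c)

lemma integrable_inner_of_memLp_two {α E : Type*} [MeasurableSpace α] {μ : Measure α}
    [NormedAddCommGroup E] [InnerProductSpace ℝ E] {f g : α → E} (hf : MemLp f 2 μ)
    (hg : MemLp g 2 μ) : Integrable (fun x => ⟪f x, g x⟫) μ := by
  refine (hf.norm.integrable_mul hg.norm).mono'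
    (hf.aestronglyMeasurable.inner hg.aestronglyMeasurable) (Eventually.of_forall fun x => ?_)
  exact norm_inner_le_norm _ _

lemma integrable_inner_of_bounded {α E : Type*} [MeasurableSpace α] {μ : Measure α}
    [NormedAddCommGroup E] [InnerProductSpace ℝ E] {f g : α → E} {c : ℝ} (hf : Integrable f μ)
    (hg : AEStronglyMeasurable g μ) (hgc : ∀ᵐ x ∂μ, ‖g x‖ ≤ c) :
    Integrable (fun x => ⟪f x, g x⟫) μ := by
  refine (hf.norm.mul_const c).mono' (hf.aestronglyMeasurable.inner hg) ?_
  filter_upwards [hgc] with x hx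
  exact (norm_inner_le_norm _ _).trans (mul_le_mul_of_nonneg_left hx (norm_nonneg _))

lemma IsTest.memLp {n : ℕ} {Ω : Set (Euc n)} {φ : Euc n → ℝ} (hφ : IsTest Ω φ)
    (p : ℝ≥0∞) : MemLp φ p (volume.restrict Ω) :=
  hφ.1.continuous.memLp_of_hasCompactSupport hφ.2.1

lemma IsTest.memLp_fderiv {n : ℕ} {Ω : Set (Euc n)} {φ : Euc n → ℝ} (hφ : IsTest Ω φ)
    (v : Euc n) (p : ℝ≥0∞) : MemLp (fun x => fderiv ℝ φ x v) p (volume.restrict Ω) := by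
  refine Continuous.memLp_of_hasCompactSupport ?_ (hφ.2.1.fderiv_apply (𝕜 := ℝ) v)
  exact (hφ.1.continuous_fderiv (by simp)).clm_apply continuous_const

lemma HasWeakGradient.add_const_mul {n : ℕ} {Ω : Set (Euc n)} {u w : Euc n → ℝ}
    {Du Dw : Euc n → Euc n} (hu : MemLp u 2 (volume.restrict Ω))
    (hDu : MemLp Du 2 (volume.restrict Ω)) (hw : MemLp w 2 (volume.restrict Ω))
    (hDw : MemLp Dw 2 (volume.restrict Ω)) (hwu : HasWeakGradient Ω u Du)
    (hww : HasWeakGradient Ω w Dw) (c : ℝ) :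
    HasWeakGradient Ω (fun x => u x + c * w x) (fun x => Du x + c • Dw x) := by
  intro φ hφ v
  have hφv : MemLp (fun x => φ x • v) 2 (volume.restrict Ω) :=
    ((ContinuousLinearMap.toSpanSingleton ℝ v).comp_memLp' (hφ.memLp 2))
  have i1 : Integrable (fun x => u x * fderiv ℝ φ x v) (volume.restrict Ω) :=
    hu.integrable_mul (hφ.memLp_fderiv v 2)
  have i2 : Integrable (fun x => w x * fderiv ℝ φ x v) (volume.restrict Ω) :=
    hw.integrable_mul (hφ.memLp_fderiv v 2)
  have j1 : Integrable (fun x => ⟪Du x, v⟫ * φ x) (volume.restrict Ω) := by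
    simpa [inner_smul_right, mul_comm] using integrable_inner_of_memLp_two hDu hφv
  have j2 : Integrable (fun x => ⟪Dw x, v⟫ * φ x) (volume.restrict Ω) := by
    simpa [inner_smul_right, mul_comm] using integrable_inner_of_memLp_two hDw hφv
  have e1 : ∀ x, (u x + c * w x) * fderiv ℝ φ x v
      = u x * fderiv ℝ φ x v + c * (w x * fderiv ℝ φ x v) := fun x => by ring
  have e2 : ∀ x, ⟪Du x + c • Dw x, v⟫ * φ x
      = ⟪Du x, v⟫ * φ x + c * (⟪Dw x, v⟫ * φ x) := fun x => by
    rw [inner_add_left, real_inner_smul_left]; ring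
  simp only [e1, e2]
  rw [integral_add i1 (i2.const_mul c), integral_add j1 (j2.const_mul c), integral_const_mul,
    integral_const_mul, hwu φ hφ v, hww φ hφ v]
  ring

lemma MemH10.zero {n : ℕ} (Ω : Set (Euc n)) : MemH10 Ω (fun _ => 0) (fun _ => 0) where
  memLp := MemLp.zero'
  memLp_grad := MemLp.zero'
  weakGradient := by intro φ _ v; simp
  approx := by
    refine ⟨fun _ _ => 0, fun _ => ⟨contDiff_const, HasCompactSupport.zero, ?_⟩, ?_, ?_⟩
    · simp [tsupport]
    · simp
    · simp

lemma tendsto_eLpNorm_add_const_smul {α E : Type*} [MeasurableSpace α] {μ : Measure α}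
    [NormedAddCommGroup E] [NormedSpace ℝ E] {f g : ℕ → α → E}
    (hf : ∀ k, AEStronglyMeasurable (f k) μ) (hg : ∀ k, AEStronglyMeasurable (g k) μ)
    (hf0 : Tendsto (fun k => eLpNorm (f k) 2 μ) atTop (𝓝 0))
    (hg0 : Tendsto (fun k => eLpNorm (g k) 2 μ) atTop (𝓝 0)) (c : ℝ) :
    Tendsto (fun k => eLpNorm (fun x => f k x + c • g k x) 2 μ) atTop (𝓝 0) := by
  have hlim : Tendsto (fun k => eLpNorm (f k) 2 μ + ‖c‖ₑ * eLpNorm (g k) 2 μ) atTop (𝓝 0) := by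
    simpa using hf0.add (ENNReal.Tendsto.const_mul (a := ‖c‖ₑ) hg0 (Or.inr (by simp)))
  refine tendsto_of_tendsto_of_tendsto_of_le_of_le tendsto_const_nhds hlim
    (fun _ => zero_le) fun k => ?_
  refine (eLpNorm_add_le (hf k) ((hg k).const_smul c) (by norm_num)).trans ?_
  gcongr
  exact (eLpNorm_const_smul c (g k) 2 μ).le

lemma MemH10.add_const_mul {n : ℕ} {Ω : Set (Euc n)} {u w : Euc n → ℝ} {Du Dw : Euc n → Euc n}
    (hu : MemH10 Ω u Du) (hw : MemH10 Ω w Dw) (c : ℝ) :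
    MemH10 Ω (fun x => u x + c * w x) (fun x => Du x + c • Dw x) where
  memLp := hu.memLp.add (hw.memLp.const_mul c)
  memLp_grad := hu.memLp_grad.add (hw.memLp_grad.const_smul c)
  weakGradient := hu.weakGradient.add_const_mul hu.memLp hu.memLp_grad hw.memLp hw.memLp_grad
    hw.weakGradient c
  approx := by
    obtain ⟨φ, hφ, hφ1, hφ2⟩ := hu.approx
    obtain ⟨ψ, hψ, hψ1, hψ2⟩ := hw.approx
    refine ⟨fun k x => φ k x + c * ψ k x, fun k => (hφ k).add_const_mul (hψ k) c, ?_, ?_⟩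
    · refine (tendsto_eLpNorm_add_const_smul (fun k => ?_) (fun k => ?_) hφ1 hψ1 c).congr
        fun k => congrArg (eLpNorm · 2 (volume.restrict Ω)) (funext fun x => ?_)
      · exact hu.memLp.aestronglyMeasurable.sub (hφ k).1.continuous.aestronglyMeasurable
      · exact hw.memLp.aestronglyMeasurable.sub (hψ k).1.continuous.aestronglyMeasurable
      · simp only [smul_eq_mul]; ring
    · refine (tendsto_eLpNorm_add_const_smul (fun k => ?_) (fun k => ?_) hφ2 hψ2 c).congr
        fun k => congrArg (eLpNorm · 2 (volume.restrict Ω)) (funext fun x => ?_)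
      · exact hu.memLp_grad.aestronglyMeasurable.sub
          (hφ k).continuous_gradient.aestronglyMeasurable
      · exact hw.memLp_grad.aestronglyMeasurable.sub
          (hψ k).continuous_gradient.aestronglyMeasurable
      · rw [(hφ k).gradient_add_const_mul (hψ k) c x, smul_sub]; abel

lemma MemH10.congr {n : ℕ} {Ω : Set (Euc n)} {u w : Euc n → ℝ} {Du Dw : Euc n → Euc n}
    (hu : MemH10 Ω u Du) (h1 : u =ᵐ[volume.restrict Ω] w) (h2 : Du =ᵐ[volume.restrict Ω] Dw) :
    MemH10 Ω w Dw where
  memLp := hu.memLp.ae_eq h1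
  memLp_grad := hu.memLp_grad.ae_eq h2
  weakGradient := by
    intro φ hφ v
    have e1 : ∫ x in Ω, w x * fderiv ℝ φ x v = ∫ x in Ω, u x * fderiv ℝ φ x v := by
      refine integral_congr_ae ?_
      filter_upwards [h1] with x hx
      rw [hx]
    have e2 : ∫ x in Ω, ⟪Dw x, v⟫ * φ x = ∫ x in Ω, ⟪Du x, v⟫ * φ x := by
      refine integral_congr_ae ?_
      filter_upwards [h2] with x hx
      rw [hx]
    rw [e1, e2]
    exact hu.weakGradient φ hφ v
  approx := by
    obtain ⟨φ, hφ, hφ1, hφ2⟩ := hu.approx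
    refine ⟨φ, hφ, hφ1.congr fun k => eLpNorm_congr_ae ?_, hφ2.congr fun k => eLpNorm_congr_ae ?_⟩
    · filter_upwards [h1] with x hx; simp only [hx]
    · filter_upwards [h2] with x hx; simp only [hx]

/-! ### A field of small norm with prescribed divergence -/

lemma ae_norm_le_of_eLpNorm_top_le {α E : Type*} [MeasurableSpace α] {μ : Measure α}
    [NormedAddCommGroup E] {f : α → E} {c : ℝ} (hc : 0 ≤ c)
    (hf : eLpNorm f ∞ μ ≤ ENNReal.ofReal c) : ∀ᵐ x ∂μ, ‖f x‖ ≤ c := by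
  rw [eLpNorm_exponent_top] at hf
  filter_upwards [ae_le_eLpNormEssSup (f := f) (μ := μ)] with x hx
  rw [← ofReal_norm] at hx
  exact (ENNReal.ofReal_le_ofReal_iff hc).1 (hx.trans hf)

lemma integral_norm_le_sqrt_mul_sqrt {α E : Type*} [MeasurableSpace α] {μ : Measure α}
    [IsFiniteMeasure μ] [NormedAddCommGroup E] {f : α → E} (hf : MemLp f 2 μ) :
    ∫ x, ‖f x‖ ∂μ ≤ √(μ.real Set.univ) * √(∫ x, ‖f x‖ ^ 2 ∂μ) := by
  have key := integral_mul_le_Lp_mul_Lq_of_nonneg (μ := μ) Real.HolderConjugate.two_two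
    (f := fun x => ‖f x‖) (g := fun _ => (1 : ℝ)) (Eventually.of_forall fun x => norm_nonneg _)
    (Eventually.of_forall fun x => zero_le_one) (by simpa using hf.norm)
    (by simpa using memLp_const (1 : ℝ))
  simp only [mul_one, Real.rpow_two, one_pow, integral_const, smul_eq_mul,
    ← Real.sqrt_eq_rpow] at key
  rwa [mul_comm]

/-- A sublinear bound by a multiple of the `L¹` norm forces an `L²` field to be bounded: test with
the restriction of the field to the set where it is too large. -/
lemma ae_norm_le_of_integral_inner_le {α E : Type*} [MeasurableSpace α] {μ : Measure α}
    [IsFiniteMeasure μ] [NormedAddCommGroup E] [InnerProductSpace ℝ E] {κ : ℝ} (hκ : 0 ≤ κ)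
    (b : Lp E 2 μ)
    (hb : ∀ p : α → E, MemLp p 2 μ → ∫ x, ⟪b x, p x⟫ ∂μ ≤ κ * ∫ x, ‖p x‖ ∂μ) :
    ∀ᵐ x ∂μ, ‖b x‖ ≤ κ := by
  set A : Set α := {x | κ < ‖b x‖}
  have hA : MeasurableSet A :=
    measurableSet_lt measurable_const (Lp.stronglyMeasurable b).norm.measurable
  have hp : MemLp (A.indicator b) 2 μ := (Lp.memLp b).indicator hA
  have h1 := hb _ hp
  have i1 : Integrable (fun x => ⟪b x, A.indicator b x⟫) μ :=
    integrable_inner_of_memLp_two (Lp.memLp b) hp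
  have i2 : Integrable (fun x => κ * ‖A.indicator b x‖) μ :=
    (hp.integrable one_le_two).norm.const_mul κ
  have hnn : ∀ x, 0 ≤ ⟪b x, A.indicator b x⟫ - κ * ‖A.indicator b x‖ := by
    intro x
    by_cases hx : x ∈ A
    · have hx' : κ < ‖b x‖ := hx
      rw [Set.indicator_of_mem hx, real_inner_self_eq_norm_sq]
      nlinarith
    · simp [Set.indicator_of_notMem hx]
  have h0 : ∫ x, (⟪b x, A.indicator b x⟫ - κ * ‖A.indicator b x‖) ∂μ = 0 := by
    refine le_antisymm ?_ (integral_nonneg hnn)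
    rw [integral_sub i1 i2, integral_const_mul]
    linarith
  rw [integral_eq_zero_iff_of_nonneg hnn (i1.sub i2)] at h0
  filter_upwards [h0] with x hx
  by_contra hlt
  have hxA : x ∈ A := not_le.1 hlt
  simp only [Set.indicator_of_mem hxA, real_inner_self_eq_norm_sq, Pi.zero_apply] at hx
  have hx' : κ < ‖b x‖ := hxA
  nlinarith

/-- The pairs `(w, Dw)` with `w ∈ H¹₀(Ω)`, as a subspace of `L²(Ω) × L²(Ω)ⁿ`. -/
def h10Submodule {n : ℕ} (Ω : Set (Euc n)) :
    Submodule ℝ (Lp ℝ 2 (volume.restrict Ω) × Lp (Euc n) 2 (volume.restrict Ω)) where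
  carrier := {q | MemH10 Ω q.1 q.2}
  zero_mem' := (MemH10.zero Ω).congr (Lp.coeFn_zero _ _ _).symm (Lp.coeFn_zero _ _ _).symm
  add_mem' := by
    intro p q hp hq
    refine (MemH10.add_const_mul hp hq 1).congr ?_ ?_
    · filter_upwards [Lp.coeFn_add p.1 q.1] with x hx
      rw [Prod.fst_add, hx, Pi.add_apply]
      simp
    · filter_upwards [Lp.coeFn_add p.2 q.2] with x hx
      rw [Prod.snd_add, hx, Pi.add_apply]
      simp
  smul_mem' := by
    intro c q hq
    refine ((MemH10.zero Ω).add_const_mul hq c).congr ?_ ?_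
    · filter_upwards [Lp.coeFn_smul c q.1] with x hx
      simp [hx]
    · filter_upwards [Lp.coeFn_smul c q.2] with x hx
      simp [hx]

/-- There is a field in `𝒟₀` of norm at most `h C_Ω`. By the Poincaré inequality the functional
`(w, Dw) ↦ - ∫ H w` is bounded by `h C_Ω ∫ |Dw|`; a Hahn–Banach extension to `L²(Ω) × L²(Ω)ⁿ` with
the same bound does not depend on the first component, and is represented by a field. -/
lemma exists_memD0_norm_le {n : ℕ} {Ω : Set (Euc n)} [IsFiniteMeasure (volume.restrict Ω)]
    {K h : ℝ} (hK : IsPoincareConst Ω K) (hh : 0 ≤ h) {H : Euc n → ℝ}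
    (hH : AEStronglyMeasurable H (volume.restrict Ω))
    (hHh : ∀ᵐ x ∂(volume.restrict Ω), ‖H x‖ ≤ h) :
    ∃ b : Euc n → Euc n, MemD0 Ω H b ∧ ∀ᵐ x ∂(volume.restrict Ω), ‖b x‖ ≤ h * K := by
  set μ := volume.restrict Ω with hμ
  have hHL : MemLp H 2 μ := MemLp.of_bound hH h hHh
  have hκ : 0 ≤ h * K := mul_nonneg hh hK.1.le
  have intp : ∀ p : Lp (Euc n) 2 μ, Integrable p μ := fun p =>
    (Lp.memLp p).integrable one_le_two
  let f : (Lp ℝ 2 μ × Lp (Euc n) 2 μ) →ₗ.[ℝ] ℝ :=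
    ⟨h10Submodule Ω, -((innerₛₗ ℝ (hHL.toLp H)) ∘ₗ LinearMap.fst ℝ _ _ ∘ₗ
      (h10Submodule Ω).subtype)⟩
  have hfval : ∀ q : f.domain, f q = -∫ x, H x * q.1.1 x ∂μ := by
    intro q
    have e : f q = -⟪hHL.toLp H, q.1.1⟫ := rfl
    rw [e, L2.inner_def]
    congr 1
    refine integral_congr_ae ?_
    filter_upwards [hHL.coeFn_toLp] with x hx
    simp [hx, mul_comm]
  let N : Lp ℝ 2 μ × Lp (Euc n) 2 μ → ℝ := fun q => h * K * ∫ x, ‖q.2 x‖ ∂μ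
  obtain ⟨g, hgf, hgN⟩ := exists_extension_of_le_sublinear f N
    (by
      intro c hc q
      have : ∫ x, ‖(c • q.2) x‖ ∂μ = c * ∫ x, ‖q.2 x‖ ∂μ := by
        rw [← integral_const_mul]
        refine integral_congr_ae ?_
        filter_upwards [Lp.coeFn_smul c q.2] with x hx
        rw [hx, Pi.smul_apply, norm_smul, Real.norm_of_nonneg hc.le]
      simp only [N, Prod.smul_snd, this]
      ring)
    (by
      intro p q
      have : ∫ x, ‖(p.2 + q.2) x‖ ∂μ ≤ ∫ x, ‖p.2 x‖ ∂μ + ∫ x, ‖q.2 x‖ ∂μ := by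
        rw [← integral_add (intp _).norm (intp _).norm]
        refine integral_mono_ae (intp _).norm ((intp _).norm.add (intp _).norm) ?_
        filter_upwards [Lp.coeFn_add p.2 q.2] with x hx
        rw [hx]
        exact norm_add_le _ _
      simp only [N, Prod.snd_add, ← mul_add]
      exact mul_le_mul_of_nonneg_left this hκ)
    (by
      intro q
      have hq : MemH10 Ω q.1.1 q.1.2 := q.2
      have hint : Integrable (fun x => |q.1.1 x|) μ := (hq.memLp.integrable one_le_two).abs
      calc f q = -∫ x, H x * q.1.1 x ∂μ := hfval q
        _ ≤ ∫ x, ‖H x * q.1.1 x‖ ∂μ := (neg_le_abs _).trans abs_integral_le_integral_abs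
        _ ≤ ∫ x, h * |q.1.1 x| ∂μ := by
            refine integral_mono_of_nonneg (Eventually.of_forall fun x => norm_nonneg _)
              (hint.const_mul h) ?_
            filter_upwards [hHh] with x hx
            rw [norm_mul]
            exact mul_le_mul_of_nonneg_right hx (abs_nonneg _)
        _ = h * ∫ x, |q.1.1 x| ∂μ := integral_const_mul _ _
        _ ≤ h * (K * ∫ x, ‖q.1.2 x‖ ∂μ) := mul_le_mul_of_nonneg_left (hK.2 _ _ hq) hh
        _ = N q.1 := by simp only [N]; ring)
  -- A linear functional with an upper bound vanishes: the bound `N` ignores the first component.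
  have hgfst : ∀ w : Lp ℝ 2 μ, g (w, 0) = 0 := by
    have hN0 : ∀ w : Lp ℝ 2 μ, g (w, 0) ≤ 0 := by
      intro w
      refine (hgN (w, 0)).trans_eq ?_
      have : ∫ x, ‖(0 : Lp (Euc n) 2 μ) x‖ ∂μ = 0 := by
        refine integral_eq_zero_of_ae ?_
        filter_upwards [Lp.coeFn_zero (Euc n) 2 μ] with x hx
        rw [hx]
        exact norm_zero
      simp only [N, this, mul_zero]
    intro w
    refine le_antisymm (hN0 w) ?_
    have h1 := hN0 (-w)
    have h2 : ((-w, 0) : Lp ℝ 2 μ × Lp (Euc n) 2 μ) = -(w, 0) := by simp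
    rw [h2, map_neg] at h1
    linarith
  have hN2 : ∀ p : Lp (Euc n) 2 μ, N (0, p) ≤ h * K * √(μ.real Set.univ) * ‖p‖ := by
    intro p
    have h1 := integral_norm_le_sqrt_mul_sqrt (Lp.memLp p)
    have h2 : ∫ x, ‖p x‖ ^ 2 ∂μ = ‖p‖ ^ 2 := by
      rw [← real_inner_self_eq_norm_sq, L2.inner_def]
      simp only [real_inner_self_eq_norm_sq]
    rw [h2, Real.sqrt_sq (norm_nonneg _)] at h1
    simp only [N, mul_assoc]
    simpa [mul_assoc] using mul_le_mul_of_nonneg_left h1 hκ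
  let ℓ : Lp (Euc n) 2 μ →L[ℝ] ℝ :=
    LinearMap.mkContinuous (g ∘ₗ LinearMap.inr ℝ _ _) (h * K * √(μ.real Set.univ)) (by
      intro p
      rw [Real.norm_eq_abs, abs_le']
      refine ⟨(hgN (0, p)).trans (hN2 p), ?_⟩
      rw [← map_neg, ← norm_neg p]
      exact (hgN (0, -p)).trans (hN2 (-p)))
  set b : Lp (Euc n) 2 μ := (InnerProductSpace.toDual ℝ _).symm ℓ with hb
  have hbℓ : ∀ p : Lp (Euc n) 2 μ, ⟪b, p⟫ = g (0, p) := fun p =>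
    InnerProductSpace.toDual_symm_apply
  refine ⟨b, ⟨Lp.memLp b, fun w Dw hw => ?_⟩, ae_norm_le_of_integral_inner_le hκ b ?_⟩
  · have hmem : MemH10 Ω (hw.memLp.toLp w) (hw.memLp_grad.toLp Dw) :=
      hw.congr hw.memLp.coeFn_toLp.symm hw.memLp_grad.coeFn_toLp.symm
    have h1 := hgf ⟨(hw.memLp.toLp w, hw.memLp_grad.toLp Dw), hmem⟩
    have h2 : g (hw.memLp.toLp w, hw.memLp_grad.toLp Dw) = ⟪b, hw.memLp_grad.toLp Dw⟫ := by
      rw [hbℓ, ← zero_add (g (0, _)), ← hgfst (hw.memLp.toLp w), ← map_add]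
      simp
    have h3 : ∫ x, ⟪Dw x, b x⟫ ∂μ = ⟪b, hw.memLp_grad.toLp Dw⟫ := by
      rw [L2.inner_def]
      refine integral_congr_ae ?_
      filter_upwards [hw.memLp_grad.coeFn_toLp] with x hx
      rw [hx, real_inner_comm]
    have h4 : ∫ x, H x * w x ∂μ = ∫ x, H x * hw.memLp.toLp w x ∂μ := by
      refine integral_congr_ae ?_
      filter_upwards [hw.memLp.coeFn_toLp] with x hx
      rw [hx]
    have i1 : Integrable (fun x => ⟪Dw x, b x⟫) μ :=
      integrable_inner_of_memLp_two hw.memLp_grad (Lp.memLp b)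
    have i2 : Integrable (fun x => H x * w x) μ := hHL.integrable_mul hw.memLp
    rw [integral_add i1 i2, h3, h4, ← h2]
    rw [hfval] at h1
    simp only at h1
    rw [h1]
    ring
  · intro p hp
    have h1 := hgN (0, hp.toLp p)
    rw [← hbℓ, L2.inner_def] at h1
    have h2 : ∫ x, ⟪b x, hp.toLp p x⟫ ∂μ = ∫ x, ⟪b x, p x⟫ ∂μ := by
      refine integral_congr_ae ?_
      filter_upwards [hp.coeFn_toLp] with x hx
      rw [hx]
    have h3 : ∫ x, ‖hp.toLp p x‖ ∂μ = ∫ x, ‖p x‖ ∂μ := by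
      refine integral_congr_ae ?_
      filter_upwards [hp.coeFn_toLp] with x hx
      rw [hx]
    simpa only [N, h2, h3] using h1

/-! ### The Euler–Lagrange equation -/

lemma hasDerivAt_norm_add_smul {E : Type*} [NormedAddCommGroup E] [InnerProductSpace ℝ E]
    {p : E} (hp : p ≠ 0) (q : E) :
    HasDerivAt (fun t : ℝ => ‖p + t • q‖) (⟪p, q⟫ / ‖p‖) 0 := by
  have h1 : HasDerivAt (fun t : ℝ => p + t • q) q 0 := by
    simpa using ((hasDerivAt_id (0 : ℝ)).smul_const q).const_add p
  have h2 := h1.norm_sq.sqrt (by simpa using hp)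
  simp only [zero_smul, add_zero, Real.sqrt_sq (norm_nonneg _)] at h2
  refine h2.congr_deriv ?_
  rw [mul_div_mul_left _ _ two_ne_zero]

/-- If `Du + F` vanishes almost nowhere, the energy is differentiable at its minimizer `u`, and
`a (Du + F) / |Du + F|` belongs to `𝒟₀`. -/
lemma IsMinimizer.memD0 {n : ℕ} {Ω : Set (Euc n)} [IsFiniteMeasure (volume.restrict Ω)]
    {a : Euc n → ℝ} {F : Euc n → Euc n} {H u : Euc n → ℝ} {Du : Euc n → Euc n} {M h : ℝ}
    (hF : Integrable F (volume.restrict Ω)) (hH : AEStronglyMeasurable H (volume.restrict Ω))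
    (hHh : ∀ᵐ x ∂(volume.restrict Ω), ‖H x‖ ≤ h)
    (ha : AEStronglyMeasurable a (volume.restrict Ω))
    (haM : ∀ᵐ x ∂(volume.restrict Ω), ‖a x‖ ≤ M) (hu : IsMinimizer Ω a F H u Du)
    (hne : ∀ᵐ x ∂(volume.restrict Ω), Du x + F x ≠ 0) :
    MemD0 Ω H (fun x => (a x / ‖Du x + F x‖) • (Du x + F x)) := by
  set μ := volume.restrict Ω with hμ
  have hHL : MemLp H 2 μ := MemLp.of_bound hH h hHh
  have iDu : Integrable Du μ := hu.1.memLp_grad.integrable one_le_two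
  have ip : Integrable (fun x => Du x + F x) μ := iDu.add hF
  have hmeas : AEStronglyMeasurable (fun x => (a x / ‖Du x + F x‖) • (Du x + F x)) μ :=
    (ha.aemeasurable.div ip.norm.aestronglyMeasurable.aemeasurable).aestronglyMeasurable.smul
      ip.aestronglyMeasurable
  have hbd : ∀ᵐ x ∂μ, ‖(a x / ‖Du x + F x‖) • (Du x + F x)‖ ≤ M := by
    filter_upwards [haM, hne] with x hx hx0
    rwa [norm_smul, norm_div, norm_norm, div_mul_cancel₀ _ (norm_ne_zero_iff.2 hx0)]
  refine ⟨MemLp.of_bound hmeas M hbd, fun w Dw hw => ?_⟩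
  have iDw : Integrable Dw μ := hw.memLp_grad.integrable one_le_two
  have iHw : Integrable (fun x => H x * w x) μ := hHL.integrable_mul hw.memLp
  have iHu : Integrable (fun x => H x * u x) μ := hHL.integrable_mul hu.1.memLp
  let Φ : ℝ → Euc n → ℝ := fun t x =>
    a x * ‖(Du x + t • Dw x) + F x‖ + H x * (u x + t * w x)
  have iΦ : ∀ t, Integrable (Φ t) μ := by
    intro t
    refine Integrable.add (((iDu.add (iDw.smul t)).add hF).norm.bdd_mul ha haM) ?_
    refine (iHu.add (iHw.const_mul t)).congr (Eventually.of_forall fun x => ?_)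
    simp only [Pi.add_apply]; ring
  have hΦd : ∀ᵐ x ∂μ, HasDerivAt (fun t => Φ t x)
      (⟪Dw x, (a x / ‖Du x + F x‖) • (Du x + F x)⟫ + H x * w x) 0 := by
    filter_upwards [hne] with x hx
    have h1 := (hasDerivAt_norm_add_smul hx (Dw x)).const_mul (a x)
    have h2 : HasDerivAt (fun t : ℝ => H x * (u x + t * w x)) (H x * w x) 0 := by
      simpa using (((hasDerivAt_id (0 : ℝ)).mul_const (w x)).const_add (u x)).const_mul (H x)
    refine ((h1.add h2).congr_deriv ?_).congr_of_eventuallyEq (Eventually.of_forall fun t => ?_)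
    · rw [real_inner_smul_right, real_inner_comm]; ring
    · simp only [Φ, Pi.add_apply]
      rw [add_right_comm]
  -- The difference quotients are dominated by `|a| |Dw| + |H w|`, uniformly in `t`.
  have hlip : ∀ᵐ x ∂μ, LipschitzOnWith (Real.nnabs (‖a x‖ * ‖Dw x‖ + ‖H x * w x‖))
      (fun t => Φ t x) Set.univ := by
    refine Eventually.of_forall fun x => LipschitzOnWith.of_dist_le_mul fun s _ t _ => ?_
    rw [Real.coe_nnabs, abs_of_nonneg (by positivity), Real.dist_eq, Real.dist_eq]
    have e : Φ s x - Φ t x = a x * (‖(Du x + s • Dw x) + F x‖ - ‖(Du x + t • Dw x) + F x‖)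
        + (H x * w x) * (s - t) := by simp only [Φ]; ring
    have h1 : |‖(Du x + s • Dw x) + F x‖ - ‖(Du x + t • Dw x) + F x‖| ≤ |s - t| * ‖Dw x‖ := by
      refine (abs_norm_sub_norm_le _ _).trans_eq ?_
      rw [← Real.norm_eq_abs, ← norm_smul, sub_smul]
      congr 1; abel
    rw [e]
    refine (abs_add_le _ _).trans ?_
    rw [abs_mul, abs_mul (H x * w x), add_mul, Real.norm_eq_abs, Real.norm_eq_abs]
    have := mul_le_mul_of_nonneg_left h1 (abs_nonneg (a x))
    linarith
  have ibound : Integrable (fun x => ‖a x‖ * ‖Dw x‖ + ‖H x * w x‖) μ :=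
    (iDw.norm.bdd_mul ha.norm (by simpa using haM)).add iHw.norm
  obtain ⟨-, hder⟩ := hasDerivAt_integral_of_dominated_loc_of_lip (μ := μ) univ_mem
    (Eventually.of_forall fun t => (iΦ t).aestronglyMeasurable) (iΦ 0)
    ((hw.memLp_grad.aestronglyMeasurable.inner hmeas).add iHw.aestronglyMeasurable)
    hlip ibound hΦd
  refine IsLocalMin.hasDerivAt_eq_zero (Eventually.of_forall fun t => ?_) hder
  have h1 := hu.2 _ _ (hu.1.add_const_mul hw t)
  simpa only [energy, Φ, zero_smul, zero_mul, add_zero] using h1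

/-! ### Stability of the dual solutions -/

lemma MemD0.combo {n : ℕ} {Ω : Set (Euc n)} {H : Euc n → ℝ} {b b' : Euc n → Euc n}
    (hH : MemLp H 2 (volume.restrict Ω)) (hb : MemD0 Ω H b) (hb' : MemD0 Ω H b') (s : ℝ) :
    MemD0 Ω H (fun x => (1 - s) • b x + s • b' x) := by
  refine ⟨(hb.1.const_smul (1 - s)).add (hb'.1.const_smul s), fun w Dw hw => ?_⟩
  have iHw : Integrable (fun x => H x * w x) (volume.restrict Ω) := hH.integrable_mul hw.memLp
  have i1 : Integrable (fun x => ⟪Dw x, b x⟫ + H x * w x) (volume.restrict Ω) :=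
    (integrable_inner_of_memLp_two hw.memLp_grad hb.1).add iHw
  have i2 : Integrable (fun x => ⟪Dw x, b' x⟫ + H x * w x) (volume.restrict Ω) :=
    (integrable_inner_of_memLp_two hw.memLp_grad hb'.1).add iHw
  have e : ∀ x, ⟪Dw x, (1 - s) • b x + s • b' x⟫ + H x * w x
      = (1 - s) * (⟪Dw x, b x⟫ + H x * w x) + s * (⟪Dw x, b' x⟫ + H x * w x) := fun x => by
    rw [inner_add_right, real_inner_smul_right, real_inner_smul_right]; ring
  simp only [e]
  rw [integral_add (i1.const_mul _) (i2.const_mul _), integral_const_mul, integral_const_mul,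
    hb.2 w Dw hw, hb'.2 w Dw hw]
  ring

/-- Against fields of `𝒟₀`, the integrand `F` may be replaced by `Du + F` at the price of a term
that does not depend on the field. -/
lemma MemD0.integral_inner_add {n : ℕ} {Ω : Set (Euc n)} {F : Euc n → Euc n}
    {H : Euc n → ℝ} {b : Euc n → Euc n} {c : ℝ} {u : Euc n → ℝ} {Du : Euc n → Euc n}
    (hF : Integrable F (volume.restrict Ω)) (hH : MemLp H 2 (volume.restrict Ω))
    (hb : MemD0 Ω H b) (hbc : ∀ᵐ x ∂(volume.restrict Ω), ‖b x‖ ≤ c) (hu : MemH10 Ω u Du) :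
    ∫ x in Ω, ⟪Du x + F x, b x⟫ = (∫ x in Ω, ⟪F x, b x⟫) - ∫ x in Ω, H x * u x := by
  have i1 := integrable_inner_of_memLp_two hu.memLp_grad hb.1
  have i2 := integrable_inner_of_bounded hF hb.1.aestronglyMeasurable hbc
  have i3 : Integrable (fun x => H x * u x) (volume.restrict Ω) := hH.integrable_mul hu.memLp
  have h1 := hb.2 u Du hu
  rw [integral_add i1 i3] at h1
  simp only [inner_add_left]
  rw [integral_add i1 i2]
  linarith

/-- The distance of a vector of length at most `a'` to the vector of length `a` in direction `p`
is controlled by the defect in `⟪p, j'⟫ ≤ a' ‖p‖`. -/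
lemma norm_smul_sub_sq_le {E : Type*} [NormedAddCommGroup E] [InnerProductSpace ℝ E]
    {p j' : E} {a a' : ℝ} (hp : p ≠ 0) (hj : ‖j'‖ ≤ a') :
    ‖(a / ‖p‖) • p - j'‖ ^ 2 ≤ (a - a') ^ 2 + 2 * (a / ‖p‖) * (a' * ‖p‖ - ⟪p, j'⟫) := by
  have hp' : ‖p‖ ≠ 0 := norm_ne_zero_iff.2 hp
  have h1 : a / ‖p‖ * ‖p‖ = a := div_mul_cancel₀ _ hp'
  have h2 : ‖(a / ‖p‖) • p‖ ^ 2 = a ^ 2 := by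
    rw [norm_smul, norm_div, norm_norm, div_mul_cancel₀ _ hp', Real.norm_eq_abs, sq_abs]
  have h3 : ‖j'‖ ^ 2 ≤ a' ^ 2 := pow_le_pow_left₀ (norm_nonneg _) hj 2
  rw [norm_sub_sq_real, h2, real_inner_smul_left]
  have h4 : 2 * (a / ‖p‖) * (a' * ‖p‖ - ⟪p, j'⟫)
      = 2 * a * a' - 2 * (a / ‖p‖ * ⟪p, j'⟫) := by
    linear_combination 2 * a' * h1
  rw [h4]
  nlinarith

lemma sigma_le_ofReal {n : ℕ} {a : Euc n → ℝ} {F Du : Euc n → Euc n} {x : Euc n} {σ₁ : ℝ}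
    (ha : 0 < a x) (hσ₁ : 0 < σ₁) (hσ : sigma a F Du x ≤ ENNReal.ofReal σ₁) :
    Du x + F x ≠ 0 ∧ a x / ‖Du x + F x‖ ≤ σ₁ := by
  have hne : Du x + F x ≠ 0 := by
    intro h0
    rw [sigma, h0, enorm_zero, ENNReal.div_zero (by simpa using ha)] at hσ
    exact ENNReal.ofReal_ne_top (top_le_iff.1 hσ)
  refine ⟨hne, ?_⟩
  have hpos : 0 < ‖Du x + F x‖ := norm_pos_iff.2 hne
  rwa [sigma, ← ofReal_norm, ← ENNReal.ofReal_div_of_pos hpos,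
    ENNReal.ofReal_le_ofReal_iff hσ₁.le] at hσ

/-- Comparison of the minimizer with `w = 0` bounds `∫ |Du + F|`. -/
lemma IsMinimizer.integral_norm_le {n : ℕ} {Ω : Set (Euc n)}
    [IsFiniteMeasure (volume.restrict Ω)] {a : Euc n → ℝ} {F : Euc n → Euc n}
    {H u : Euc n → ℝ} {Du : Euc n → Euc n} {K m M k₁ h : ℝ} (hK : IsPoincareConst Ω K)
    (hm : 0 < m) (hM : 0 < M) (hh : 0 ≤ h) (hhm : h * K < m)
    (hF : Integrable F (volume.restrict Ω)) (hFk : ∫ x in Ω, ‖F x‖ ≤ k₁)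
    (hH : AEStronglyMeasurable H (volume.restrict Ω))
    (hHh : ∀ᵐ x ∂(volume.restrict Ω), ‖H x‖ ≤ h)
    (ha : AEStronglyMeasurable a (volume.restrict Ω))
    (haM : ∀ᵐ x ∂(volume.restrict Ω), m ≤ a x ∧ a x ≤ M) (hu : IsMinimizer Ω a F H u Du) :
    ∫ x in Ω, ‖Du x + F x‖ ≤ (M + h * K) * k₁ / (m - h * K) := by
  set μ := volume.restrict Ω with hμ
  have haM' : ∀ᵐ x ∂μ, ‖a x‖ ≤ M := by
    filter_upwards [haM] with x hx
    rw [Real.norm_of_nonneg (hm.le.trans hx.1)]; exact hx.2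
  have hHL : MemLp H 2 μ := MemLp.of_bound hH h hHh
  have iDu : Integrable Du μ := hu.1.memLp_grad.integrable one_le_two
  have ip : Integrable (fun x => Du x + F x) μ := iDu.add hF
  have iu : Integrable (fun x => |u x|) μ := (hu.1.memLp.integrable one_le_two).abs
  have iHu : Integrable (fun x => H x * u x) μ := hHL.integrable_mul hu.1.memLp
  have iap : Integrable (fun x => a x * ‖Du x + F x‖) μ := ip.norm.bdd_mul ha haM'
  have hE := hu.2 _ _ (MemH10.zero Ω)
  simp only [energy, zero_add, mul_zero, add_zero] at hE
  rw [integral_add iap iHu] at hE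
  have h1 : ∫ x, a x * ‖F x‖ ∂μ ≤ M * ∫ x, ‖F x‖ ∂μ := by
    rw [← integral_const_mul]
    refine integral_mono_ae (hF.norm.bdd_mul ha haM') (hF.norm.const_mul M) ?_
    filter_upwards [haM] with x hx
    exact mul_le_mul_of_nonneg_right hx.2 (norm_nonneg _)
  have h2 : m * ∫ x, ‖Du x + F x‖ ∂μ ≤ ∫ x, a x * ‖Du x + F x‖ ∂μ := by
    rw [← integral_const_mul]
    refine integral_mono_ae (ip.norm.const_mul m) iap ?_
    filter_upwards [haM] with x hx
    exact mul_le_mul_of_nonneg_right hx.1 (norm_nonneg _)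
  have h3 : -(h * ∫ x, |u x| ∂μ) ≤ ∫ x, H x * u x ∂μ := by
    rw [← integral_const_mul, ← integral_neg]
    refine integral_mono_ae (iu.const_mul h).neg iHu ?_
    filter_upwards [hHh] with x hx
    have : |H x * u x| ≤ h * |u x| := by
      rw [abs_mul]; exact mul_le_mul_of_nonneg_right hx (abs_nonneg _)
    exact (abs_le.1 this).1
  have h4 : h * ∫ x, |u x| ∂μ ≤ h * K * ∫ x, ‖Du x‖ ∂μ := by
    rw [mul_assoc]; exact mul_le_mul_of_nonneg_left (hK.2 u Du hu.1) hh
  have h5 : ∫ x, ‖Du x‖ ∂μ ≤ ∫ x, ‖Du x + F x‖ ∂μ + ∫ x, ‖F x‖ ∂μ := by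
    rw [← integral_add ip.norm hF.norm]
    refine integral_mono iDu.norm (ip.norm.add hF.norm) fun x => ?_
    simpa using norm_sub_le (Du x + F x) (F x)
  have hκ : 0 ≤ h * K := mul_nonneg hh hK.1.le
  have h6 := mul_le_mul_of_nonneg_left h5 hκ
  have h7 := mul_le_mul_of_nonneg_left hFk hM.le
  have h8 := mul_le_mul_of_nonneg_left hFk hκ
  rw [le_div_iff₀ (sub_pos.2 hhm)]
  linarith

/-- The normalized field belongs to `𝒟₀` and attains the upper bound `∫ a |Du + F|` of
`∫ ⟪Du + F, b⟫` over admissible `b`. Every dual solution thus attains it too, and is therefore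
parallel to `Du + F` with length `a`. -/
lemma IsDualSolution.ae_eq_normalized {n : ℕ} {Ω : Set (Euc n)}
    [IsFiniteMeasure (volume.restrict Ω)] {a : Euc n → ℝ} {F : Euc n → Euc n}
    {H u : Euc n → ℝ} {Du J : Euc n → Euc n} {M h : ℝ}
    (hF : Integrable F (volume.restrict Ω)) (hH : AEStronglyMeasurable H (volume.restrict Ω))
    (hHh : ∀ᵐ x ∂(volume.restrict Ω), ‖H x‖ ≤ h)
    (ha : AEStronglyMeasurable a (volume.restrict Ω))
    (haM : ∀ᵐ x ∂(volume.restrict Ω), 0 ≤ a x ∧ a x ≤ M) (hu : IsMinimizer Ω a F H u Du)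
    (hne : ∀ᵐ x ∂(volume.restrict Ω), Du x + F x ≠ 0) (hJ : IsDualSolution Ω a F H J) :
    ∀ᵐ x ∂(volume.restrict Ω), J x = (a x / ‖Du x + F x‖) • (Du x + F x) := by
  set μ := volume.restrict Ω with hμ
  set J₀ : Euc n → Euc n := fun x => (a x / ‖Du x + F x‖) • (Du x + F x) with hJ₀
  have haM' : ∀ᵐ x ∂μ, ‖a x‖ ≤ M := by
    filter_upwards [haM] with x hx
    rw [Real.norm_of_nonneg hx.1]; exact hx.2
  have hHL : MemLp H 2 μ := MemLp.of_bound hH h hHh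
  have ip : Integrable (fun x => Du x + F x) μ :=
    (hu.1.memLp_grad.integrable one_le_two).add hF
  have iap : Integrable (fun x => a x * ‖Du x + F x‖) μ := ip.norm.bdd_mul ha haM'
  have hD : MemD0 Ω H J₀ := hu.memD0 hF hH hHh ha haM' hne
  have hJ₀a : ∀ᵐ x ∂μ, ‖J₀ x‖ ≤ a x := by
    filter_upwards [haM, hne] with x hx hx0
    rw [hJ₀, norm_smul, norm_div, norm_norm, div_mul_cancel₀ _ (norm_ne_zero_iff.2 hx0),
      Real.norm_of_nonneg hx.1]
  have hJ₀M : ∀ᵐ x ∂μ, ‖J₀ x‖ ≤ M := by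
    filter_upwards [haM, hJ₀a] with x hx hx1 using hx1.trans hx.2
  have hJM : ∀ᵐ x ∂μ, ‖J x‖ ≤ M := by
    filter_upwards [haM, hJ.1.2] with x hx hx1 using hx1.trans hx.2
  have e0 := hD.integral_inner_add hF hHL hJ₀M hu.1
  have e1 := hJ.1.1.integral_inner_add hF hHL hJM hu.1
  have hopt := hJ.2 J₀ ⟨hD, hJ₀a⟩
  have e2 : ∫ x, ⟪Du x + F x, J₀ x⟫ ∂μ = ∫ x, a x * ‖Du x + F x‖ ∂μ := by
    refine integral_congr_ae ?_
    filter_upwards [hne] with x hx0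
    have : ‖Du x + F x‖ ≠ 0 := norm_ne_zero_iff.2 hx0
    simp only [hJ₀]
    rw [real_inner_smul_right, real_inner_self_eq_norm_sq]
    field_simp
  have ipJ : Integrable (fun x => ⟪Du x + F x, J x⟫) μ :=
    integrable_inner_of_bounded ip hJ.1.1.1.aestronglyMeasurable hJM
  have hnn : 0 ≤ᵐ[μ] fun x => a x * ‖Du x + F x‖ - ⟪Du x + F x, J x⟫ := by
    filter_upwards [hJ.1.2] with x hx
    have h1 := real_inner_le_norm (Du x + F x) (J x)
    have h2 := mul_le_mul_of_nonneg_left hx (norm_nonneg (Du x + F x))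
    simp only [Pi.zero_apply]
    linarith
  have h0 : ∫ x, (a x * ‖Du x + F x‖ - ⟪Du x + F x, J x⟫) ∂μ = 0 := by
    refine le_antisymm ?_ (integral_nonneg_of_ae hnn)
    rw [integral_sub iap ipJ]
    linarith
  rw [integral_eq_zero_iff_of_nonneg_ae hnn (iap.sub ipJ)] at h0
  filter_upwards [h0, hne, hJ.1.2] with x hx hx0 hxa
  have h1 := norm_smul_sub_sq_le (a := a x) hx0 hxa
  simp only [Pi.zero_apply] at hx
  rw [hx, sub_self, mul_zero, zero_pow two_ne_zero, add_zero] at h1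
  have h2 : ‖(a x / ‖Du x + F x‖) • (Du x + F x) - J x‖ = 0 :=
    pow_eq_zero_iff two_ne_zero |>.1 (le_antisymm h1 (sq_nonneg _))
  exact (sub_eq_zero.1 (norm_eq_zero.1 h2)).symm

/-- The constant of the stability estimate, in terms of `V = |Ω|` and `κ = h C_Ω`. The first summand
serves `‖a - a'‖_∞ ≤ m - κ`; its factor `(M + κ) k₁ / (m - κ)` bounds `∫ |Du + F|`. The second
serves the remaining case. -/
noncomputable def stabilityConst (V κ m M k₁ σ₁ : ℝ) : ℝ :=
  √V * √(M * V + 2 * σ₁ * (((M + κ) * k₁ / (m - κ)) * (1 + (M + κ) / (m - κ))))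
    + 2 * M * V / √(m - κ)

/-- The value of the dual problem for `a'` is almost that for `a`. The competitor
`(1 - s) J + s b₀`, where `b₀ ∈ 𝒟₀` has norm at most `κ < m`, is admissible for `a'` when
`s (m - κ) ≥ ‖a - a'‖_∞`. -/
lemma integral_defect_le {n : ℕ} {Ω : Set (Euc n)} [IsFiniteMeasure (volume.restrict Ω)]
    {a a' : Euc n → ℝ} {F : Euc n → Euc n} {H u : Euc n → ℝ} {Du J J' b₀ : Euc n → Euc n}
    {m M κ δ : ℝ} (hm : 0 < m) (hκm : κ < m) (hδ : 0 ≤ δ) (hδm : δ ≤ m - κ)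
    (hF : Integrable F (volume.restrict Ω)) (hH : MemLp H 2 (volume.restrict Ω))
    (ha' : AEStronglyMeasurable a' (volume.restrict Ω))
    (haM : ∀ᵐ x ∂(volume.restrict Ω), m ≤ a x ∧ a x ≤ M)
    (haM' : ∀ᵐ x ∂(volume.restrict Ω), m ≤ a' x ∧ a' x ≤ M)
    (hd : ∀ᵐ x ∂(volume.restrict Ω), |a x - a' x| ≤ δ) (hu : MemH10 Ω u Du)
    (hb₀ : MemD0 Ω H b₀) (hb₀κ : ∀ᵐ x ∂(volume.restrict Ω), ‖b₀ x‖ ≤ κ)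
    (hJ : IsDualFeasible Ω a H J) (hJ' : IsDualSolution Ω a' F H J')
    (hJp : ∀ᵐ x ∂(volume.restrict Ω), ⟪Du x + F x, J x⟫ = a x * ‖Du x + F x‖) :
    ∫ x in Ω, (a' x * ‖Du x + F x‖ - ⟪Du x + F x, J' x⟫)
      ≤ δ * (1 + (M + κ) / (m - κ)) * ∫ x in Ω, ‖Du x + F x‖ := by
  set μ := volume.restrict Ω with hμ
  have hpos : 0 < m - κ := sub_pos.2 hκm
  set s : ℝ := δ / (m - κ) with hs
  have hs0 : 0 ≤ s := div_nonneg hδ hpos.le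
  have hs1 : s ≤ 1 := (div_le_one hpos).2 hδm
  have hsδ : s * (m - κ) = δ := div_mul_cancel₀ _ hpos.ne'
  have ip : Integrable (fun x => Du x + F x) μ :=
    (hu.memLp_grad.integrable one_le_two).add hF
  have hJM : ∀ᵐ x ∂μ, ‖J x‖ ≤ M := by
    filter_upwards [haM, hJ.2] with x hx hx1 using hx1.trans hx.2
  have hJM' : ∀ᵐ x ∂μ, ‖J' x‖ ≤ M := by
    filter_upwards [haM', hJ'.1.2] with x hx hx1 using hx1.trans hx.2
  set b : Euc n → Euc n := fun x => (1 - s) • J x + s • b₀ x with hb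
  have hbD : MemD0 Ω H b := hJ.1.combo hH hb₀ s
  have hba : ∀ᵐ x ∂μ, ‖b x‖ ≤ a' x := by
    filter_upwards [haM, hd, hb₀κ, hJ.2] with x hx hxd hxb hxJ
    have h1 : ‖b x‖ ≤ (1 - s) * ‖J x‖ + s * ‖b₀ x‖ := by
      refine (norm_add_le _ _).trans_eq ?_
      rw [norm_smul, norm_smul, Real.norm_of_nonneg hs0, Real.norm_of_nonneg (sub_nonneg.2 hs1)]
    have h2 := mul_le_mul_of_nonneg_left hxJ (sub_nonneg.2 hs1)
    have h3 := mul_le_mul_of_nonneg_left hxb hs0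
    have h4 := mul_le_mul_of_nonneg_left hx.1 hs0
    have h5 := (abs_le.1 hxd).2
    linarith
  have hbM : ∀ᵐ x ∂μ, ‖b x‖ ≤ M := by
    filter_upwards [haM', hba] with x hx hx1 using hx1.trans hx.2
  have hopt := hJ'.2 b ⟨hbD, hba⟩
  have e1 := hbD.integral_inner_add hF hH hbM hu
  have e2 := hJ'.1.1.integral_inner_add hF hH hJM' hu
  have iap : Integrable (fun x => a' x * ‖Du x + F x‖) μ := by
    refine ip.norm.bdd_mul (c := M) ha' ?_
    filter_upwards [haM'] with x hx
    rw [Real.norm_of_nonneg (hm.le.trans hx.1)]; exact hx.2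
  have ipb : Integrable (fun x => ⟪Du x + F x, b x⟫) μ :=
    integrable_inner_of_bounded ip hbD.1.aestronglyMeasurable hbM
  have ipJ' : Integrable (fun x => ⟪Du x + F x, J' x⟫) μ :=
    integrable_inner_of_bounded ip hJ'.1.1.1.aestronglyMeasurable hJM'
  have h1 : ∫ x, (a' x * ‖Du x + F x‖ - ⟪Du x + F x, b x⟫) ∂μ
      ≤ ∫ x, δ * (1 + (M + κ) / (m - κ)) * ‖Du x + F x‖ ∂μ := by
    refine integral_mono_ae (iap.sub ipb) (ip.norm.const_mul _) ?_
    filter_upwards [haM, hd, hb₀κ, hJp] with x hx hxd hxb hxJ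
    set p := Du x + F x
    have g1 : ⟪p, b x⟫ = (1 - s) * (a x * ‖p‖) + s * ⟪p, b₀ x⟫ := by
      simp only [hb]
      rw [inner_add_right, real_inner_smul_right, real_inner_smul_right, hxJ]
    have g2 : -(‖p‖ * κ) ≤ ⟪p, b₀ x⟫ :=
      (neg_le_neg (mul_le_mul_of_nonneg_left hxb (norm_nonneg p))).trans
        (abs_le.1 (abs_real_inner_le_norm p (b₀ x))).1
    have g3 := mul_le_mul_of_nonneg_left g2 hs0
    have g4 : (a' x - a x) * ‖p‖ ≤ δ * ‖p‖ :=
      mul_le_mul_of_nonneg_right (by linarith [(abs_le.1 hxd).1]) (norm_nonneg p)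
    have g5 := mul_le_mul_of_nonneg_left
      (mul_le_mul_of_nonneg_right hx.2 (norm_nonneg p)) hs0
    have g6 : δ * (1 + (M + κ) / (m - κ)) * ‖p‖ = δ * ‖p‖ + s * (M + κ) * ‖p‖ := by
      rw [hs]; ring
    simp only [g1, g6]
    linarith
  rw [integral_sub iap ipb, integral_const_mul] at h1
  rw [integral_sub iap ipJ']
  linarith

/-- The stability estimate in real form, for any bound `δ` of `|a - a'|`. -/
lemma integral_norm_sub_le {n : ℕ} {Ω : Set (Euc n)} [IsFiniteMeasure (volume.restrict Ω)]
    {K m M k₁ σ₁ h δ : ℝ} (hK : IsPoincareConst Ω K) (hm : 0 < m) (hM : 0 < M) (hσ₁ : 0 < σ₁)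
    (hh : 0 ≤ h) (hhm : h * K < m) (hδ : 0 ≤ δ)
    {F : Euc n → Euc n} {H a a' u : Euc n → ℝ} {Du J J' : Euc n → Euc n}
    (hF : Integrable F (volume.restrict Ω)) (hFk : ∫ x in Ω, ‖F x‖ ≤ k₁)
    (hH : AEStronglyMeasurable H (volume.restrict Ω))
    (hHh : ∀ᵐ x ∂(volume.restrict Ω), ‖H x‖ ≤ h)
    (ha : AEStronglyMeasurable a (volume.restrict Ω))
    (ha' : AEStronglyMeasurable a' (volume.restrict Ω))
    (haM : ∀ᵐ x ∂(volume.restrict Ω), m ≤ a x ∧ a x ≤ M)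
    (haM' : ∀ᵐ x ∂(volume.restrict Ω), m ≤ a' x ∧ a' x ≤ M)
    (hd : ∀ᵐ x ∂(volume.restrict Ω), |a x - a' x| ≤ δ) (hu : IsMinimizer Ω a F H u Du)
    (hσ : ∀ᵐ x ∂(volume.restrict Ω), sigma a F Du x ≤ ENNReal.ofReal σ₁)
    (hJ : IsDualSolution Ω a F H J) (hJ' : IsDualSolution Ω a' F H J') :
    ∫ x in Ω, ‖J x - J' x‖
      ≤ stabilityConst ((volume.restrict Ω).real Set.univ) (h * K) m M k₁ σ₁ * √δ := by
  set μ := volume.restrict Ω with hμ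
  set V := μ.real Set.univ with hV
  set κ := h * K with hκ
  have hV0 : 0 ≤ V := measureReal_nonneg
  have hκ0 : 0 ≤ κ := mul_nonneg hh hK.1.le
  have hpos : 0 < m - κ := sub_pos.2 hhm
  have hk₁ : 0 ≤ k₁ := (integral_nonneg fun x => norm_nonneg (F x)).trans hFk
  have hJM : ∀ᵐ x ∂μ, ‖J x‖ ≤ M := by
    filter_upwards [haM, hJ.1.2] with x hx hx1 using hx1.trans hx.2
  have hJM' : ∀ᵐ x ∂μ, ‖J' x‖ ≤ M := by
    filter_upwards [haM', hJ'.1.2] with x hx hx1 using hx1.trans hx.2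
  have hL2 : MemLp (fun x => J x - J' x) 2 μ := hJ.1.1.1.sub hJ'.1.1.1
  unfold stabilityConst
  rcases le_total (m - κ) δ with hδm | hδm
  · -- For large `δ` the bound `|J - J'| ≤ 2 M` suffices.
    have h1 : ∫ x, ‖J x - J' x‖ ∂μ ≤ 2 * M * V := by
      have : ∫ x, ‖J x - J' x‖ ∂μ ≤ ∫ _, 2 * M ∂μ := by
        refine integral_mono_ae (hL2.integrable one_le_two).norm (integrable_const _) ?_
        filter_upwards [hJM, hJM'] with x h1 h2
        exact (norm_sub_le _ _).trans (by linarith)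
      rwa [integral_const, smul_eq_mul, mul_comm] at this
    have h2 : 1 ≤ √δ / √(m - κ) :=
      (one_le_div (Real.sqrt_pos.2 hpos)).2 (Real.sqrt_le_sqrt hδm)
    have h3 : 2 * M * V * 1 ≤ 2 * M * V * (√δ / √(m - κ)) :=
      mul_le_mul_of_nonneg_left h2 (by positivity)
    have h4 : 0 ≤ √V * √(M * V + 2 * σ₁ * (((M + κ) * k₁ / (m - κ))
        * (1 + (M + κ) / (m - κ)))) * √δ := by positivity
    have h5 : 2 * M * V / √(m - κ) * √δ = 2 * M * V * (√δ / √(m - κ)) := by ring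
    rw [add_mul, h5]
    linarith
  · have hHL : MemLp H 2 μ := MemLp.of_bound hH h hHh
    have ip : Integrable (fun x => Du x + F x) μ :=
      (hu.1.memLp_grad.integrable one_le_two).add hF
    have hσ' : ∀ᵐ x ∂μ, Du x + F x ≠ 0 ∧ a x / ‖Du x + F x‖ ≤ σ₁ := by
      filter_upwards [haM, hσ] with x hx hx1 using sigma_le_ofReal (hm.trans_le hx.1) hσ₁ hx1
    have hJeq := hJ.ae_eq_normalized hF hH hHh ha
      (haM.mono fun x hx => ⟨hm.le.trans hx.1, hx.2⟩) hu (hσ'.mono fun x hx => hx.1)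
    have hJp : ∀ᵐ x ∂μ, ⟪Du x + F x, J x⟫ = a x * ‖Du x + F x‖ := by
      filter_upwards [hJeq, hσ'] with x hx hx0
      have : ‖Du x + F x‖ ≠ 0 := norm_ne_zero_iff.2 hx0.1
      rw [hx, real_inner_smul_right, real_inner_self_eq_norm_sq]
      field_simp
    obtain ⟨b₀, hb₀, hb₀κ⟩ := exists_memD0_norm_le hK hh hH hHh
    have hgap := integral_defect_le hm hhm hδ hδm hF hHL ha' haM haM' hd hu.1 hb₀ hb₀κ hJ.1
      hJ' hJp
    have hP := hu.integral_norm_le hK hm hM hh hhm hF hFk hH hHh ha haM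
    have iap : Integrable (fun x => a' x * ‖Du x + F x‖) μ := by
      refine ip.norm.bdd_mul (c := M) ha' ?_
      filter_upwards [haM'] with x hx
      rw [Real.norm_of_nonneg (hm.le.trans hx.1)]; exact hx.2
    have ipJ' : Integrable (fun x => ⟪Du x + F x, J' x⟫) μ :=
      integrable_inner_of_bounded ip hJ'.1.1.1.aestronglyMeasurable hJM'
    have idef : Integrable (fun x => a' x * ‖Du x + F x‖ - ⟪Du x + F x, J' x⟫) μ :=
      iap.sub ipJ'
    have hsq : ∫ x, ‖J x - J' x‖ ^ 2 ∂μ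
        ≤ ∫ x, (M * δ + 2 * σ₁ * (a' x * ‖Du x + F x‖ - ⟪Du x + F x, J' x⟫)) ∂μ := by
      refine integral_mono_ae (hL2.integrable_norm_pow two_ne_zero)
        ((integrable_const _).add (idef.const_mul _)) ?_
      filter_upwards [haM, haM', hd, hJeq, hσ', hJ'.1.2] with x hx hx' hxd hxJ hxσ hxJ'
      have g1 := norm_smul_sub_sq_le (a := a x) hxσ.1 hxJ'
      rw [← hxJ] at g1
      have g2 : 0 ≤ a' x * ‖Du x + F x‖ - ⟪Du x + F x, J' x⟫ := by
        have h1 := real_inner_le_norm (Du x + F x) (J' x)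
        have h2 := mul_le_mul_of_nonneg_left hxJ' (norm_nonneg (Du x + F x))
        linarith
      have g3 := mul_le_mul_of_nonneg_right hxσ.2 g2
      -- Both coefficients lie in `[0, M]`, so one factor of the square is at most `M`.
      have g4 : |a x - a' x| ≤ M := abs_le.2 ⟨by linarith, by linarith⟩
      have g5 : (a x - a' x) ^ 2 ≤ M * δ := by
        rw [← sq_abs, sq]
        exact mul_le_mul g4 hxd (abs_nonneg _) hM.le
      linarith
    rw [integral_add (integrable_const _) (idef.const_mul _), integral_const,
      smul_eq_mul, integral_const_mul] at hsq
    set P := (M + κ) * k₁ / (m - κ) with hPdef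
    have hR : 0 ≤ 1 + (M + κ) / (m - κ) := by positivity
    have hsq' : ∫ x, ‖J x - J' x‖ ^ 2 ∂μ
        ≤ (M * V + 2 * σ₁ * (P * (1 + (M + κ) / (m - κ)))) * δ := by
      have h1 := mul_le_mul_of_nonneg_left hP (mul_nonneg hδ hR)
      have h2 := mul_le_mul_of_nonneg_left (hgap.trans h1) (by positivity : 0 ≤ 2 * σ₁)
      refine hsq.trans ((add_le_add_right h2 _).trans_eq ?_)
      ring
    have h1 := integral_norm_le_sqrt_mul_sqrt hL2
    have h2 := mul_le_mul_of_nonneg_left (Real.sqrt_le_sqrt hsq') (Real.sqrt_nonneg V)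
    rw [Real.sqrt_mul' _ hδ, ← mul_assoc] at h2
    have h3 : 0 ≤ 2 * M * V / √(m - κ) * √δ := by positivity
    rw [add_mul]
    linarith

end WeightedLeastGradient

open WeightedLeastGradient in
theorem mainTheorem4 (n : ℕ) (Ω : Set (EuclideanSpace ℝ (Fin n)))
    (hΩ_open : IsOpen Ω) (hΩ_bdd : Bornology.IsBounded Ω)
    (CΩ : ℝ) (hCΩ : IsPoincareConst Ω CΩ)
    (m M k₁ σ₁ h : ℝ) (hm : 0 < m) (hM : 0 < M) (hk₁ : 0 < k₁) (hσ₁ : 0 < σ₁)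
    (hh₀ : 0 ≤ h) (hh : h < m / CΩ) :
    ∃ C : ℝ≥0, ∀ (F : EuclideanSpace ℝ (Fin n) → EuclideanSpace ℝ (Fin n))
      (H a a' : EuclideanSpace ℝ (Fin n) → ℝ),
      MemLp F 1 (volume.restrict Ω) →
      eLpNorm F 1 (volume.restrict Ω) ≤ ENNReal.ofReal k₁ →
      MemLp H ∞ (volume.restrict Ω) →
      eLpNorm H ∞ (volume.restrict Ω) ≤ ENNReal.ofReal h →
      AEStronglyMeasurable a (volume.restrict Ω) →
      AEStronglyMeasurable a' (volume.restrict Ω) →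
      (∀ᵐ x ∂(volume.restrict Ω), m ≤ a x ∧ a x ≤ M) →
      (∀ᵐ x ∂(volume.restrict Ω), m ≤ a' x ∧ a' x ≤ M) →
      ∀ (u : EuclideanSpace ℝ (Fin n) → ℝ)
        (Du : EuclideanSpace ℝ (Fin n) → EuclideanSpace ℝ (Fin n)),
        IsMinimizer Ω a F H u Du →
        (∀ᵐ x ∂(volume.restrict Ω), sigma a F Du x ≤ ENNReal.ofReal σ₁) →
        ∀ J J' : EuclideanSpace ℝ (Fin n) → EuclideanSpace ℝ (Fin n),
          IsDualSolution Ω a F H J →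
          IsDualSolution Ω a' F H J' →
          eLpNorm (fun x => J x - J' x) 1 (volume.restrict Ω) ≤
            C * eLpNorm (fun x => a x - a' x) ∞ (volume.restrict Ω) ^ (1 / 2 : ℝ) := by
  have hfin : IsFiniteMeasure (volume.restrict Ω) :=
    isFiniteMeasure_restrict.2 hΩ_bdd.measure_lt_top.ne
  set μ := volume.restrict Ω with hμ
  refine ⟨(stabilityConst (μ.real Set.univ) (h * CΩ) m M k₁ σ₁).toNNReal, ?_⟩
  intro F H a a' hF hFk hH hHh ha ha' haM haM' u Du hu hσ J J' hJ hJ'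
  have hhm : h * CΩ < m := (lt_div_iff₀ hCΩ.1).1 hh
  have hFi : Integrable F μ := memLp_one_iff_integrable.1 hF
  have hFk' : ∫ x, ‖F x‖ ∂μ ≤ k₁ := by
    rwa [eLpNorm_one_eq_lintegral_enorm, ← ofReal_integral_norm_eq_lintegral_enorm hFi,
      ENNReal.ofReal_le_ofReal_iff hk₁.le] at hFk
  have hd : MemLp (fun x => a x - a' x) ∞ μ := by
    refine MemLp.of_bound (ha.sub ha') M ?_
    filter_upwards [haM, haM'] with x hx hx'
    exact abs_le.2 ⟨by linarith, by linarith⟩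
  set δ := (eLpNorm (fun x => a x - a' x) ∞ μ).toReal with hδ
  have hδe : eLpNorm (fun x => a x - a' x) ∞ μ = ENNReal.ofReal δ :=
    (ENNReal.ofReal_toReal hd.eLpNorm_ne_top).symm
  have hδ0 : 0 ≤ δ := ENNReal.toReal_nonneg
  have key := integral_norm_sub_le hCΩ hm hM hσ₁ hh₀ hhm hδ0 hFi hFk' hH.aestronglyMeasurable
    (ae_norm_le_of_eLpNorm_top_le hh₀ hHh) ha ha' haM haM'
    (ae_norm_le_of_eLpNorm_top_le hδ0 hδe.le) hu hσ hJ hJ'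
  have hJJ : Integrable (fun x => J x - J' x) μ :=
    (hJ.1.1.1.sub hJ'.1.1.1).integrable one_le_two
  rw [hδe, eLpNorm_one_eq_lintegral_enorm, ← ofReal_integral_norm_eq_lintegral_enorm hJJ,
    ENNReal.ofReal_rpow_of_nonneg hδ0 (by norm_num), ← Real.sqrt_eq_rpow]
  refine (ENNReal.ofReal_le_ofReal key).trans_eq ?_
  rw [ENNReal.ofReal_mul' (Real.sqrt_nonneg _)]
  rfl
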